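/- Let $G$ be a finite, simple, undirected, connected graph of order $n\ge 3$, with complement $\overline G$. For a set $S\subseteq V(G)$ with $|S|\ge 2$, a Steiner tree connecting $S$ is a subgraph of $G$ that is a tree and whose vertex set contains $S$; let $\lambda(S)$ be the maximum number of pairwise edge-disjoint Steiner trees in $G$ connecting $S$, and let $\lambda_3(G)=\min\{\lambda(S): S\subseteq V(G),\ |S|=3\}$. Write $P_m$, $C_m$, $K_m$ for the path, cycle and complete graph on $m$ vertices, $mH$ for the disjoint union of $m$ copies of $H$ (empty if $m=0$), and let $\cup$ denote disjoint union and $=$ isomorphism. Then $\lambda_3(G)=n-3$ if and only if one of the following holds: 1. $\overline G= rP_2\cup (n-2r)K_1$ for some integer $r$ with $2\le r\le \lfloor n/2\rfloor$; 2. $\overline G= P_4\cup sP_2\cup (n-2s-4)K_1$ for some integer $s$ with $0\le s\le \lfloor (n-4)/2\rfloor$; 3. $\overline G= P_3\cup tP_2\cup (n-2t-3)K_1$ for some integer $t$ with $0\le t\le \lfloor (n-3)/2\rfloor$; 4. $\overline G= C_3\cup tP_2\cup (n-2t-3)K_1$ for some integer $t$ with $0\le t\le \lfloor (n-3)/2\rfloor$.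 -/

import Mathlib

namespace SimpleGraph

/-- A subgraph `T` of `G` is a Steiner tree connecting `S` if it is a tree whose vertex set
contains `S`. -/
def IsSteinerTree {V : Type*} {G : SimpleGraph V} (S : Set V) (T : G.Subgraph) : Prop :=
  T.coe.IsTree ∧ S ⊆ T.verts

/-- `G` contains `m` pairwise edge-disjoint Steiner trees connecting `S`. -/
def HasEdgeDisjointSteinerTrees {V : Type*} (G : SimpleGraph V) (S : Set V) (m : ℕ) : Prop :=
  ∃ T : Fin m → G.Subgraph, (∀ i, IsSteinerTree S (T i)) ∧
    ∀ i j, i ≠ j → Disjoint (T i).edgeSet (T j).edgeSet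

/-- The generalized local edge-connectivity `λ(S)`: the maximum number of pairwise edge-disjoint
Steiner trees connecting `S` in `G` (meaningful for finite `G` and `2 ≤ |S|`, when the set of
these numbers is bounded, see `bddAbove_hasEdgeDisjointSteinerTrees`). -/
noncomputable def localSteinerEdgeConnectivity {V : Type*} (G : SimpleGraph V) (S : Set V) : ℕ :=
  sSup {m : ℕ | G.HasEdgeDisjointSteinerTrees S m}

/-- The generalized `k`-edge-connectivity `λ_k(G)`: the minimum of `λ(S)` over all `k`-element
sets `S` of vertices (meaningful for finite `G` and `2 ≤ k ≤ |V|`; it is `0` for such `k` when `G`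
is disconnected). -/
noncomputable def generalizedEdgeConnectivity {V : Type*} (G : SimpleGraph V) (k : ℕ) : ℕ :=
  sInf {l : ℕ | ∃ S : Finset V, S.card = k ∧ G.localSteinerEdgeConnectivity (S : Set V) = l}

/-- `m H`: the disjoint union of `m` copies of `H`. -/
def copies {W : Type*} (m : ℕ) (H : SimpleGraph W) : SimpleGraph (Fin m × W) where
  Adj a b := a.1 = b.1 ∧ H.Adj a.2 b.2
  symm.symm _ _ h := ⟨h.1.symm, h.2.symm⟩
  loopless.irrefl _ h := H.irrefl h.2

/-- A Steiner tree connecting at least two vertices has an edge. -/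
theorem IsSteinerTree.edgeSet_nonempty {V : Type*} {G : SimpleGraph V} {S : Set V}
    (hS : S.Nontrivial) {T : G.Subgraph} (hT : IsSteinerTree S T) : T.edgeSet.Nonempty := by
  obtain ⟨x, hx, y, hy, hxy⟩ := hS
  have : Nontrivial T.verts :=
    ⟨⟨x, hT.2 hx⟩, ⟨y, hT.2 hy⟩, fun h => hxy (congrArg Subtype.val h)⟩
  obtain ⟨w, hw⟩ := hT.1.connected.preconnected.exists_adj_of_nontrivial ⟨x, hT.2 hx⟩
  exact ⟨s(x, w), hw⟩

/-- In a finite graph, if `S` has at least two vertices, then the numbers of edge-disjoint Steiner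
trees connecting `S` are bounded, so that the supremum defining `λ(S)` is a maximum. -/
theorem bddAbove_hasEdgeDisjointSteinerTrees {V : Type*} [Finite V] (G : SimpleGraph V)
    {S : Set V} (hS : S.Nontrivial) :
    BddAbove {m : ℕ | G.HasEdgeDisjointSteinerTrees S m} := by
  refine ⟨Nat.card (Sym2 V), ?_⟩
  rintro m ⟨T, hT, hd⟩
  choose e he using fun i => (hT i).edgeSet_nonempty hS
  have hinj : Function.Injective e := by
    intro i j hij
    by_contra hne
    exact Set.disjoint_left.1 (hd i j hne) (he i) (hij ▸ he j)
  simpa using Nat.card_le_card_of_injective e hinj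

end SimpleGraph

/-! The complement of $G$ decides everything through a local condition, `IsNearMatching`: maximum
degree at most 2, with any two vertices of degree 2 adjacent. The value $n-3$ occurs exactly when
the complement is a near-matching with at least two edges
(`generalizedEdgeConnectivity_three_eq_iff`).

Upper bounds come from degrees. The trees use distinct edges at each vertex of $S$, so their number
is at most its degree. If $u,v\in S$ are adjacent in $G$ and both have degree at most the number of
trees, then both are leaves of every tree and all their edges are used; the tree through $uv$ is
then just that edge and misses the third vertex of $S$ (`not_hasEdgeDisjointSteinerTrees_of_adj`).

Lower bounds come from stars. Each of the $n-3$ vertices outside $S=\{x,y,z\}$ is the centre of a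
star to $S$. Since few edges are missing, the stars can be repaired with the edges inside $S$, or by
detours through one outside vertex $w_0$ whose own tree is built from edges inside $S$.
`hasEdgeDisjointSteinerTrees_of_scheme` turns such an allocation of edges into trees. If at most one
edge is missing and $n\ge 4$, the edges inside $S$ suffice for one further tree, so $n-2$ trees
exist.

Finally, near-matchings are classified (`isNearMatching_and_hasTwoEdges_iff`). At most three
vertices have degree 2, as they are pairwise adjacent; none, one, two or three of them give $rP_2$,
$P_3$, $P_4$ or $C_3$, up to further copies of $P_2$ and isolated vertices. -/

namespace SimpleGraph

/-! ### Steiner trees from connected pieces, and lower bounds on $\lambda_3$ as existence of trees.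
-/

/-- The part of a subgraph `F` of `G` in which `x` lies contains a Steiner tree connecting any set
of vertices that are reachable from `x` in `F`. -/
theorem exists_isSteinerTree_of_reachable {V : Type*} {G F : SimpleGraph V} (hF : F ≤ G)
    {S : Set V} (x : V) (hS : ∀ v ∈ S, F.Reachable x v) :
    ∃ T : G.Subgraph, IsSteinerTree S T ∧ T.edgeSet ⊆ F.edgeSet := by
  set C : Set V := (F.connectedComponentMk x).supp with hC
  have hconn : (F.induce C).Connected := (F.connectedComponentMk x).connected_toSimpleGraph
  obtain ⟨T₀, hle, hT₀⟩ := hconn.exists_isTree_le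
  let T : G.Subgraph :=
    { verts := C
      Adj := fun u v => ∃ (hu : u ∈ C) (hv : v ∈ C), T₀.Adj ⟨u, hu⟩ ⟨v, hv⟩
      adj_sub := fun ⟨_, _, h⟩ => hF (hle h)
      edge_vert := fun ⟨hu, _, _⟩ => hu
      symm := ⟨fun _ _ ⟨hu, hv, h⟩ => ⟨hv, hu, h.symm⟩⟩ }
  have hT : T.coe = T₀ := by
    ext u v
    exact ⟨fun ⟨_, _, h⟩ => h, fun h => ⟨u.2, v.2, h⟩⟩
  refine ⟨T, ⟨hT ▸ hT₀, fun v hv => ?_⟩, ?_⟩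
  · exact ConnectedComponent.sound (hS v hv).symm
  · intro e
    induction e with
    | _ u v => exact fun ⟨_, _, h⟩ => hle h

/-- Pairwise edge-disjoint subgraphs in each of which `S` lies in one component yield
edge-disjoint Steiner trees. -/
theorem hasEdgeDisjointSteinerTrees_of_reachable {V ι : Type*} {G : SimpleGraph V} {S : Set V}
    (x : V) (I : Finset ι) (F : ι → SimpleGraph V) (hF : ∀ i, F i ≤ G)
    (hd : ∀ i j u v, (F i).Adj u v → (F j).Adj u v → i = j)
    (hS : ∀ i ∈ I, ∀ v ∈ S, (F i).Reachable x v) :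
    G.HasEdgeDisjointSteinerTrees S I.card := by
  choose T hT hTF using fun i : I => exists_isSteinerTree_of_reachable (hF i) x (hS i i.2)
  refine ⟨fun k => T (I.equivFin.symm k), fun k => hT _, fun k l hkl => ?_⟩
  rw [Set.disjoint_left]
  intro e
  induction e with
  | _ u v =>
    intro h₁ h₂
    exact hkl (I.equivFin.symm.injective (Subtype.ext (hd _ _ u v (hTF _ h₁) (hTF _ h₂))))

theorem HasEdgeDisjointSteinerTrees.mono {V : Type*} {G : SimpleGraph V} {S : Set V} {m k : ℕ}
    (h : G.HasEdgeDisjointSteinerTrees S m) (hk : k ≤ m) : G.HasEdgeDisjointSteinerTrees S k := by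
  obtain ⟨T, hT, hd⟩ := h
  exact ⟨fun i => T (Fin.castLE hk i), fun i => hT _,
    fun i j hij => hd _ _ fun h => hij (Fin.castLE_injective hk h)⟩

theorem hasEdgeDisjointSteinerTrees_zero {V : Type*} (G : SimpleGraph V) (S : Set V) :
    G.HasEdgeDisjointSteinerTrees S 0 :=
  ⟨Fin.elim0, fun i => i.elim0, fun i => i.elim0⟩

theorem Connected.hasEdgeDisjointSteinerTrees_one {V : Type*} {G : SimpleGraph V}
    (hG : G.Connected) (S : Set V) : G.HasEdgeDisjointSteinerTrees S 1 := by
  have := hG.nonempty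
  obtain ⟨x⟩ := this
  obtain ⟨T, hT, -⟩ := exists_isSteinerTree_of_reachable le_rfl (S := S) x
    fun v _ => hG.preconnected x v
  exact ⟨fun _ => T, fun _ => hT, fun i j hij => absurd (Subsingleton.elim i j) hij⟩

theorem le_localSteinerEdgeConnectivity_iff {V : Type*} [Finite V] (G : SimpleGraph V)
    {S : Set V} (hS : S.Nontrivial) (m : ℕ) :
    m ≤ G.localSteinerEdgeConnectivity S ↔ G.HasEdgeDisjointSteinerTrees S m := by
  have hb := bddAbove_hasEdgeDisjointSteinerTrees G hS
  refine ⟨fun h => ?_, fun h => le_csSup hb h⟩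
  exact (Nat.sSup_mem ⟨0, hasEdgeDisjointSteinerTrees_zero G S⟩ hb).mono h

theorem le_generalizedEdgeConnectivity_iff {V : Type*} [Fintype V] (G : SimpleGraph V)
    {k : ℕ} (hk : 2 ≤ k) (hkV : k ≤ Fintype.card V) (m : ℕ) :
    m ≤ G.generalizedEdgeConnectivity k ↔
      ∀ S : Finset V, S.card = k → G.HasEdgeDisjointSteinerTrees (S : Set V) m := by
  have hnt : ∀ S : Finset V, S.card = k → (S : Set V).Nontrivial := fun S hS =>
    Finset.one_lt_card_iff_nontrivial.1 (by omega)
  have hne : {l : ℕ | ∃ S : Finset V, S.card = k ∧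
      G.localSteinerEdgeConnectivity (S : Set V) = l}.Nonempty := by
    obtain ⟨S, -, hS⟩ := Finset.exists_subset_card_eq (s := Finset.univ) hkV
    exact ⟨_, S, hS, rfl⟩
  rw [generalizedEdgeConnectivity, le_csInf_iff (OrderBot.bddBelow _) hne]
  constructor
  · exact fun h S hS => (le_localSteinerEdgeConnectivity_iff G (hnt S hS) m).1 (h _ ⟨S, hS, rfl⟩)
  · rintro h _ ⟨S, hS, rfl⟩
    exact (le_localSteinerEdgeConnectivity_iff G (hnt S hS) m).2 (h S hS)

/-! ### Degree obstructions to many edge-disjoint Steiner trees. -/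

/-- Every vertex of a Steiner tree connecting at least two vertices has a neighbour in it. -/
theorem IsSteinerTree.exists_adj {V : Type*} {G : SimpleGraph V} {S : Set V}
    (hS : S.Nontrivial) {T : G.Subgraph} (hT : IsSteinerTree S T) {u : V} (hu : u ∈ S) :
    ∃ w, T.Adj u w := by
  obtain ⟨y, hy, hyu⟩ := hS.exists_ne u
  have : Nontrivial T.verts :=
    ⟨⟨u, hT.2 hu⟩, ⟨y, hT.2 hy⟩, fun h => hyu (congrArg Subtype.val h).symm⟩
  obtain ⟨w, hw⟩ := hT.1.connected.preconnected.exists_adj_of_nontrivial ⟨u, hT.2 hu⟩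
  exact ⟨w, hw⟩

theorem Subgraph.eq_of_adj_of_adj {V ι : Type*} {G : SimpleGraph V} {T : ι → G.Subgraph}
    (hd : ∀ i j, i ≠ j → Disjoint (T i).edgeSet (T j).edgeSet) {i j : ι} {u v : V}
    (hi : (T i).Adj u v) (hj : (T j).Adj u v) : i = j := by
  by_contra hne
  exact Set.disjoint_left.1 (hd i j hne) (Subgraph.mem_edgeSet.2 hi) (Subgraph.mem_edgeSet.2 hj)

/-- Picking one edge at `u` from each tree gives distinct edges, by disjointness. -/
theorem HasEdgeDisjointSteinerTrees.le_degree {V : Type*} [Fintype V] {G : SimpleGraph V}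
    [DecidableRel G.Adj] {S : Set V} (hS : S.Nontrivial) {m : ℕ}
    (h : G.HasEdgeDisjointSteinerTrees S m) {u : V} (hu : u ∈ S) : m ≤ G.degree u := by
  obtain ⟨T, hT, hd⟩ := h
  choose a ha using fun i => (hT i).exists_adj hS hu
  have hinj : Function.Injective fun i => (⟨a i, (T i).adj_sub (ha i)⟩ : G.neighborSet u) := by
    intro i j hij
    have hij : a i = a j := congrArg Subtype.val hij
    exact Subgraph.eq_of_adj_of_adj hd (ha i) (hij ▸ ha j)
  rw [← card_neighborSet_eq_degree]
  simpa only [Fintype.card_fin] using Fintype.card_le_of_injective _ hinj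

/-- If `u` has degree at most the number of edge-disjoint Steiner trees then `u` is a leaf of each
tree, and every edge at `u` lies in one of the trees. -/
theorem exists_adj_of_degree_le {V : Type*} [Fintype V] {G : SimpleGraph V}
    [DecidableRel G.Adj] {S : Set V} (hS : S.Nontrivial) {m : ℕ} {T : Fin m → G.Subgraph}
    (hT : ∀ i, IsSteinerTree S (T i))
    (hd : ∀ i j, i ≠ j → Disjoint (T i).edgeSet (T j).edgeSet)
    {u : V} (hu : u ∈ S) (hm : G.degree u ≤ m) :
    (∀ v, G.Adj u v → ∃ i, (T i).Adj u v) ∧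
      ∀ i v w, (T i).Adj u v → (T i).Adj u w → v = w := by
  choose a ha using fun i => (hT i).exists_adj hS hu
  have hinj : Function.Injective fun i => (⟨a i, (T i).adj_sub (ha i)⟩ : G.neighborSet u) := by
    intro i j hij
    have hij : a i = a j := congrArg Subtype.val hij
    exact Subgraph.eq_of_adj_of_adj hd (ha i) (hij ▸ ha j)
  -- There are no more neighbours than trees, so the injection from trees to neighbours is a
  -- bijection: every edge at `u` is the chosen edge of one tree.
  have hsurj := (hinj.bijective_of_nat_card_le (by
    rwa [Nat.card_eq_fintype_card, Nat.card_eq_fintype_card, card_neighborSet_eq_degree,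
      Fintype.card_fin])).2
  have key : ∀ v, G.Adj u v → ∃ i, a i = v := fun v hv => by
    obtain ⟨i, hi⟩ := hsurj ⟨v, hv⟩
    exact ⟨i, congrArg Subtype.val hi⟩
  have leaf : ∀ i v, (T i).Adj u v → a i = v := by
    intro i v hv
    obtain ⟨j, rfl⟩ := key v ((T i).adj_sub hv)
    rw [Subgraph.eq_of_adj_of_adj hd hv (ha j)]
  refine ⟨fun v hv => ?_, fun i v w hv hw => (leaf i v hv).symm.trans (leaf i w hw)⟩
  obtain ⟨i, rfl⟩ := key v hv
  exact ⟨i, ha i⟩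

/-- Two adjacent vertices of a set with at least three elements cannot both have degree at most the
number of edge-disjoint Steiner trees connecting the set. -/
theorem not_hasEdgeDisjointSteinerTrees_of_adj {V : Type*} [Fintype V] {G : SimpleGraph V}
    [DecidableRel G.Adj] {S : Set V} {m : ℕ} {u v x : V} (hu : u ∈ S) (hv : v ∈ S) (hx : x ∈ S)
    (hxu : x ≠ u) (hxv : x ≠ v) (huv : G.Adj u v) (hmu : G.degree u ≤ m) (hmv : G.degree v ≤ m) :
    ¬ G.HasEdgeDisjointSteinerTrees S m := by
  rintro ⟨T, hT, hd⟩
  have hS : S.Nontrivial := ⟨u, hu, v, hv, huv.ne⟩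
  obtain ⟨hu₁, hu₂⟩ := exists_adj_of_degree_le hS hT hd hu hmu
  obtain ⟨-, hv₂⟩ := exists_adj_of_degree_le hS hT hd hv hmv
  obtain ⟨i, hi⟩ := hu₁ v huv
  have hreach := (hT i).1.connected.preconnected ⟨u, (hT i).2 hu⟩ ⟨x, (hT i).2 hx⟩
  -- In the tree containing `uv` both ends are leaves, so nothing beyond `u` and `v` can be reached.
  have hclosed : ∀ w : (T i).verts, (T i).coe.Reachable ⟨u, (hT i).2 hu⟩ w →
      (w : V) = u ∨ (w : V) = v := by
    intro w hw
    rw [reachable_iff_reflTransGen] at hw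
    induction hw with
    | refl => exact Or.inl rfl
    | tail _ hbc ih =>
      rcases ih with h | h
      · exact Or.inr (hu₂ i _ _ (h ▸ hbc) hi)
      · exact Or.inl (hv₂ i _ _ (h ▸ hbc) hi.symm)
  exact (hclosed _ hreach).elim hxu hxv

/-! ### Stars with repairs: constructing $n-3$ trees. -/

/-- A scheme for edge-disjoint Steiner trees connecting `{x, y, z}`, indexed by a set `I` of
vertices. The tree of a vertex `w` outside `{x, y, z}` other than `w₀` may use the edges from `w` to
`x`, `y`, `z` and `w₀`. The edges `w₀x`, `w₀y`, `w₀z` are given to the trees `fx`, `fy`, `fz`, and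
the edges `yz`, `zx`, `xy` to the trees `gx`, `gy`, `gz`. Connectedness is expressed through
properties `P` that are invariant along the edges of a tree. -/
theorem hasEdgeDisjointSteinerTrees_of_scheme {V : Type*} {G : SimpleGraph V} {x y z w₀ : V}
    (hxy : x ≠ y) (hyz : y ≠ z) (hzx : z ≠ x) (h₀x : w₀ ≠ x) (h₀y : w₀ ≠ y) (h₀z : w₀ ≠ z)
    (fx fy fz gx gy gz : V) (I : Finset V)
    (h : ∀ w ∈ I, ∀ P : V → Prop,
      (w ≠ x → w ≠ y → w ≠ z → w ≠ w₀ → (G.Adj w x → (P w ↔ P x)) ∧ (G.Adj w y → (P w ↔ P y)) ∧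
        (G.Adj w z → (P w ↔ P z)) ∧ (G.Adj w w₀ → (P w ↔ P w₀))) →
      (fx = w → G.Adj w₀ x → (P w₀ ↔ P x)) → (fy = w → G.Adj w₀ y → (P w₀ ↔ P y)) →
      (fz = w → G.Adj w₀ z → (P w₀ ↔ P z)) → (gx = w → G.Adj y z → (P y ↔ P z)) →
      (gy = w → G.Adj z x → (P z ↔ P x)) → (gz = w → G.Adj x y → (P x ↔ P y)) →
      (P x ↔ P y) ∧ (P x ↔ P z)) :
    G.HasEdgeDisjointSteinerTrees {x, y, z} I.card := by
  let R : V → V → V → Prop := fun w u v =>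
    (u = w ∧ w ≠ x ∧ w ≠ y ∧ w ≠ z ∧ w ≠ w₀ ∧ (v = x ∨ v = y ∨ v = z ∨ v = w₀)) ∨
    (u = w₀ ∧ (v = x ∧ fx = w ∨ v = y ∧ fy = w ∨ v = z ∧ fz = w)) ∨
    (u = y ∧ v = z ∧ gx = w) ∨ (u = z ∧ v = x ∧ gy = w) ∨ (u = x ∧ v = y ∧ gz = w)
  let F : V → SimpleGraph V := fun w =>
    { Adj := fun u v => G.Adj u v ∧ (R w u v ∨ R w v u)
      symm := ⟨fun _ _ h => ⟨h.1.symm, h.2.symm⟩⟩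
      loopless := ⟨fun _ h => h.1.ne rfl⟩ }
  refine hasEdgeDisjointSteinerTrees_of_reachable x I F (fun _ _ _ h => h.1) ?_ ?_
  · rintro i j u v ⟨-, h₁⟩ ⟨-, h₂⟩
    clear h
    simp only [R] at h₁ h₂
    -- Every edge has a single owner: an edge with an end outside `{x, y, z, w₀}` belongs to that
    -- end, and the six remaining edges are allotted once each by `fx`, …, `gz`.
    grind (splits := 30)
  · intro w hw
    have hP : ∀ u v, (F w).Adj u v → ((F w).Reachable x u ↔ (F w).Reachable x v) := fun u v huv =>
      ⟨fun h => h.trans huv.reachable, fun h => h.trans huv.symm.reachable⟩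
    have key := h w hw ((F w).Reachable x)
      (fun h₁ h₂ h₃ h₄ => ⟨fun ha => hP _ _ ⟨ha, .inl (.inl ⟨rfl, h₁, h₂, h₃, h₄, by simp⟩)⟩,
        fun ha => hP _ _ ⟨ha, .inl (.inl ⟨rfl, h₁, h₂, h₃, h₄, by simp⟩)⟩,
        fun ha => hP _ _ ⟨ha, .inl (.inl ⟨rfl, h₁, h₂, h₃, h₄, by simp⟩)⟩,
        fun ha => hP _ _ ⟨ha, .inl (.inl ⟨rfl, h₁, h₂, h₃, h₄, by simp⟩)⟩⟩)
      (fun hf ha => hP _ _ ⟨ha, .inl (.inr (.inl ⟨rfl, by simp [hf]⟩))⟩)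
      (fun hf ha => hP _ _ ⟨ha, .inl (.inr (.inl ⟨rfl, by simp [hf]⟩))⟩)
      (fun hf ha => hP _ _ ⟨ha, .inl (.inr (.inl ⟨rfl, by simp [hf]⟩))⟩)
      (fun hf ha => hP _ _ ⟨ha, .inl (.inr (.inr (.inl ⟨rfl, rfl, hf⟩)))⟩)
      (fun hf ha => hP _ _ ⟨ha, .inl (.inr (.inr (.inr (.inl ⟨rfl, rfl, hf⟩))))⟩)
      (fun hf ha => hP _ _ ⟨ha, .inl (.inr (.inr (.inr (.inr ⟨rfl, rfl, hf⟩))))⟩)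
    have hx : (F w).Reachable x x := Reachable.refl x
    rintro v (rfl | rfl | rfl)
    · exact hx
    · exact key.1.1 hx
    · exact key.2.1 hx

/-- No vertex has three neighbours, and any two vertices with two neighbours are adjacent. -/
def IsNearMatching {V : Type*} (H : SimpleGraph V) : Prop :=
  (∀ v a b c, H.Adj v a → H.Adj v b → H.Adj v c → a = b ∨ b = c ∨ a = c) ∧
    ∀ u v a b c d, u ≠ v → a ≠ b → c ≠ d → H.Adj u a → H.Adj u b → H.Adj v c → H.Adj v d →
      H.Adj u v

/-- The graph has two different edges. -/
def HasTwoEdges {V : Type*} (H : SimpleGraph V) : Prop :=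
  ∃ a b c d, H.Adj a b ∧ H.Adj c d ∧ s(a, b) ≠ s(c, d)

/-- Names the exceptional vertex that needs a repair edge; `w₀` is the default when there is none.
-/
theorem exists_forall_eq_of_forall_eq {V : Type*} {p : V → Prop} (w₀ : V)
    (hp : ∀ a b, p a → p b → a = b) : ∃ a, (a = w₀ ∨ p a) ∧ ∀ w, p w → w = a := by
  by_cases h : ∃ a, p a
  · obtain ⟨a, ha⟩ := h
    exact ⟨a, .inr ha, fun w hw => hp _ _ hw ha⟩
  · exact ⟨w₀, .inl rfl, fun w hw => absurd ⟨w, hw⟩ h⟩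

theorem adj_or_compl_adj {V : Type*} {G : SimpleGraph V} {a b : V} (h : a ≠ b) :
    G.Adj a b ∨ Gᶜ.Adj b a := by
  rw [compl_adj, G.adj_comm b a]
  tauto

section

variable {V : Type*} [Fintype V] [DecidableEq V] {G : SimpleGraph V} {x y z w₀ : V}

/-- Edge-disjoint Steiner trees when `x` is not adjacent to `y` and `z`. -/
theorem hasEdgeDisjointSteinerTrees_of_two_nonadj (hL : Gᶜ.IsNearMatching)
    (hxy : Gᶜ.Adj x y) (hxz : Gᶜ.Adj x z) (hyz : y ≠ z) (h₀ : w₀ ≠ x ∧ w₀ ≠ y ∧ w₀ ≠ z) :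
    G.HasEdgeDisjointSteinerTrees {x, y, z} ({x, y, z} : Finset V)ᶜ.card := by
  obtain ⟨h1, h2⟩ := hL
  -- If `y` and `z` both had a non-neighbour outside the triple, both would have complement degree
  -- at least 2, hence be adjacent in the complement, and `y` would have three complement
  -- neighbours.
  have key : ∀ w w', w ≠ x → w' ≠ x → w ≠ z → w' ≠ y → Gᶜ.Adj y w → Gᶜ.Adj z w' → False := by
    intro w w' h₁ h₂ h₃ h₄ hyw hzw
    have := h2 y z x w x w' hyz h₁.symm h₂.symm hxy.symm hyw hxz.symm hzw
    grind [h1 y x z w hxy.symm this hyw, hxz.ne]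
  obtain ⟨u, -, hu⟩ := exists_forall_eq_of_forall_eq
    (p := fun w => (w ≠ x ∧ w ≠ y ∧ w ≠ z) ∧ (Gᶜ.Adj y w ∨ Gᶜ.Adj z w)) w₀ (by
      rintro a b ⟨ha, ha'⟩ ⟨hb, hb'⟩
      have := h1 y x a b hxy.symm
      have := h1 z x a b hxz.symm
      have := key a b
      have := key b a
      grind)
  -- Only the star at `u` can lack an edge, to one of `y` and `z`; the edge `yz` repairs it.
  refine hasEdgeDisjointSteinerTrees_of_scheme (w₀ := w₀) hxy.ne hyz hxz.ne.symm
    h₀.1 h₀.2.1 h₀.2.2 w₀ w₀ w₀ u u u _ fun w hw P h₃ h₄ h₅ h₆ h₇ h₈ h₉ => ?_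
  simp only [Finset.mem_compl, Finset.mem_insert, Finset.mem_singleton, not_or] at hw
  have hx := (adj_or_compl_adj (G := G) hw.1).resolve_right fun h => by
    have := h1 x y z w hxy hxz h
    grind
  have hy := adj_or_compl_adj (G := G) hw.2.1
  have hz := adj_or_compl_adj (G := G) hw.2.2
  have hyz' := adj_or_compl_adj (G := G) hyz
  have k₁ := hu w
  have k₂ := key w w
  have k₃ := h1 y x z w hxy.symm
  have k₄ := h1 z x y w hxz.symm
  have k₅ := Gᶜ.adj_comm y z
  have k₆ := hxy.ne
  have k₇ := hxz.ne
  clear h1 h2 key hu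
  have h₃ := h₃ hw.1 hw.2.1 hw.2.2
  by_cases e₀ : w = w₀
  all_goals by_cases e₁ : u = w
  all_goals grind

/-- Edge-disjoint Steiner trees when `xy` is the only non-edge inside `{x, y, z}`, and `z` has two
non-neighbours. -/
theorem hasEdgeDisjointSteinerTrees_of_one_nonadj_of_apex (hL : Gᶜ.IsNearMatching)
    (hxy : Gᶜ.Adj x y) (hxz : G.Adj x z) (hyz : G.Adj y z) {a b : V} (hab : a ≠ b)
    (ha : Gᶜ.Adj z a) (hb : Gᶜ.Adj z b) :
    G.HasEdgeDisjointSteinerTrees {x, y, z} ({x, y, z} : Finset V)ᶜ.card := by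
  obtain ⟨h1, h2⟩ := hL
  have hax : ∀ {v}, G.Adj v z → ∀ {c}, Gᶜ.Adj z c → c ≠ v := by
    rintro v hv c hc rfl
    exact hc.2 hv.symm
  have full : ∀ u v w, Gᶜ.Adj u v → G.Adj u z → w ≠ v → ¬ Gᶜ.Adj u w := fun u v w huv huz hwv huw =>
    (h2 u z v w a b huz.ne hwv.symm hab huv huw ha hb).2 huz
  -- Only the stars at `a` and `b` are defective, each missing `z`: the edge `yz` repairs `a`, and
  -- `zx` repairs `b`.
  refine hasEdgeDisjointSteinerTrees_of_scheme (w₀ := a) hxy.ne hyz.ne hxz.ne.symm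
    (hax hxz ha) (hax hyz ha) ha.ne.symm a a a b a a _ fun w hw P h₃ h₄ h₅ h₆ h₇ h₈ h₉ => ?_
  simp only [Finset.mem_compl, Finset.mem_insert, Finset.mem_singleton, not_or] at hw
  have hx := (adj_or_compl_adj (G := G) hw.1).resolve_right (full x y w hxy hxz hw.2.1)
  have hy := (adj_or_compl_adj (G := G) hw.2.1).resolve_right (full y x w hxy.symm hyz hw.1)
  have hz := adj_or_compl_adj (G := G) hw.2.2
  have k₁ := h1 z a b w ha hb
  have k₂ := hxz.symm
  clear h1 h2 full hax
  have h₃ := h₃ hw.1 hw.2.1 hw.2.2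
  by_cases e₀ : w = a
  all_goals by_cases e₁ : b = w
  all_goals grind

/-- Edge-disjoint Steiner trees when `xy` is the only non-edge inside `{x, y, z}`, and all other
edges at `x` and `y` are present. -/
theorem hasEdgeDisjointSteinerTrees_of_one_nonadj_of_full
    (hxy : Gᶜ.Adj x y) (hxz : G.Adj x z) (hyz : G.Adj y z) (h₀ : w₀ ≠ x ∧ w₀ ≠ y ∧ w₀ ≠ z)
    (hx : ∀ w, w ≠ y → ¬ Gᶜ.Adj x w) (hy : ∀ w, w ≠ x → ¬ Gᶜ.Adj y w)
    (hz : ∀ a b, Gᶜ.Adj z a → Gᶜ.Adj z b → a = b) :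
    G.HasEdgeDisjointSteinerTrees {x, y, z} ({x, y, z} : Finset V)ᶜ.card := by
  obtain ⟨z₁, -, hz₁⟩ := exists_forall_eq_of_forall_eq w₀ hz
  refine hasEdgeDisjointSteinerTrees_of_scheme (w₀ := w₀) hxy.ne hyz.ne hxz.ne.symm
    h₀.1 h₀.2.1 h₀.2.2 w₀ w₀ w₀ z₁ z₁ z₁ _ fun w hw P h₃ h₄ h₅ h₆ h₇ h₈ h₉ => ?_
  simp only [Finset.mem_compl, Finset.mem_insert, Finset.mem_singleton, not_or] at hw
  have hx := (adj_or_compl_adj (G := G) hw.1).resolve_right (hx w hw.2.1)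
  have hy := (adj_or_compl_adj (G := G) hw.2.1).resolve_right (hy w hw.1)
  have hz := adj_or_compl_adj (G := G) hw.2.2
  have k₁ := hz₁ w
  have k₂ := hxz.symm
  clear hz₁
  have h₃ := h₃ hw.1 hw.2.1 hw.2.2
  by_cases e₀ : w = w₀
  all_goals by_cases e₁ : z₁ = w
  all_goals grind

/-- Edge-disjoint Steiner trees when `xy` is the only non-edge inside `{x, y, z}`, and `x` has
another non-neighbour `a`. -/
theorem hasEdgeDisjointSteinerTrees_of_one_nonadj_of_nonadj (hL : Gᶜ.IsNearMatching)
    (hxy : Gᶜ.Adj x y) (hxz : G.Adj x z) (hyz : G.Adj y z) {a : V} (hay : a ≠ y)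
    (ha : Gᶜ.Adj x a) :
    G.HasEdgeDisjointSteinerTrees {x, y, z} ({x, y, z} : Finset V)ᶜ.card := by
  obtain ⟨h1, h2⟩ := hL
  have haz : a ≠ z := by
    rintro rfl
    exact ha.2 hxz
  -- Any other vertex of complement degree 2 is a complement neighbour of `x`, and these are only
  -- `y` and `a`.
  have hdeg : ∀ v b c, b ≠ c → Gᶜ.Adj v b → Gᶜ.Adj v c → v ≠ x → v = y ∨ v = a := by
    intro v b c hbc hb hc hv
    have := h1 x y a v hxy ha (h2 x v y a b c hv.symm hay.symm hbc hxy ha hb hc)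
    grind
  obtain ⟨y₁, hy₁, hy₁'⟩ := exists_forall_eq_of_forall_eq
    (p := fun w => (w ≠ x ∧ w ≠ y ∧ w ≠ z) ∧ Gᶜ.Adj y w) a (by
      rintro b c ⟨hb, hb'⟩ ⟨hc, hc'⟩
      have := h1 y x b c hxy.symm hb' hc'
      grind)
  obtain ⟨z₁, hz₁, hz₁'⟩ := exists_forall_eq_of_forall_eq
    (p := fun w => (w ≠ x ∧ w ≠ y ∧ w ≠ z) ∧ Gᶜ.Adj z w) a (by
      rintro b c ⟨hb, hb'⟩ ⟨hc, hc'⟩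
      by_contra hbc
      have := hdeg z b c hbc hb' hc' hxz.ne.symm
      have := hyz.ne
      grind)
  -- The tree of `a` is the path `y`–`z`–`x`. This frees the edges `ay` and `az`, through which `y₁`
  -- and `z₁` make a detour to the vertex they miss.
  refine hasEdgeDisjointSteinerTrees_of_scheme (w₀ := a) hxy.ne hyz.ne hxz.ne.symm
    ha.ne.symm hay haz a y₁ z₁ a a a _ fun w hw P h₃ h₄ h₅ h₆ h₇ h₈ h₉ => ?_
  simp only [Finset.mem_compl, Finset.mem_insert, Finset.mem_singleton, not_or] at hw
  have hx := adj_or_compl_adj (G := G) hw.1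
  have hy := adj_or_compl_adj (G := G) hw.2.1
  have hz := adj_or_compl_adj (G := G) hw.2.2
  have hay' := adj_or_compl_adj (G := G) hay
  have haz' := adj_or_compl_adj (G := G) haz
  have k₁ := hy₁' w
  have k₂ := hz₁' w
  have k₃ := hy₁' a
  have k₄ := hz₁' a
  have k₅ := h1 x y a w hxy ha
  have hya : w ≠ a → Gᶜ.Adj y w → G.Adj w a := fun hwa hyw =>
    (adj_or_compl_adj hwa).resolve_right fun h => by
      have := hdeg w a y hay h.symm hyw.symm hw.1
      grind
  have hza : w ≠ a → Gᶜ.Adj z w → G.Adj w a := fun hwa hzw =>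
    (adj_or_compl_adj hwa).resolve_right fun h => by
      have := hdeg w a z haz h.symm hzw.symm hw.1
      grind
  have hyz₁ : w ≠ a → Gᶜ.Adj z w → ¬ Gᶜ.Adj y w := fun hwa hzw hyw => by
    have := hdeg w y z hyz.ne hyw.symm hzw.symm hw.1
    grind
  have k₆ := hxz.symm
  have k₇ := ha.ne
  clear h1 h2 hdeg hy₁' hz₁'
  have h₃ := h₃ hw.1 hw.2.1 hw.2.2
  by_cases e₀ : w = a
  all_goals by_cases e₁ : y₁ = w
  all_goals by_cases e₂ : z₁ = w
  all_goals grind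

/-- Edge-disjoint Steiner trees when `{x, y, z}` is a triangle and `x` has two non-neighbours. -/
theorem hasEdgeDisjointSteinerTrees_of_triangle_of_apex (hL : Gᶜ.IsNearMatching)
    (hxy : G.Adj x y) (hxz : G.Adj x z) (hyz : G.Adj y z) {a b : V} (hab : a ≠ b)
    (ha : Gᶜ.Adj x a) (hb : Gᶜ.Adj x b) (hby : ¬ Gᶜ.Adj y b) (hbz : ¬ Gᶜ.Adj z b) :
    G.HasEdgeDisjointSteinerTrees {x, y, z} ({x, y, z} : Finset V)ᶜ.card := by
  obtain ⟨h1, h2⟩ := hL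
  have hne : ∀ {v}, G.Adj x v → ∀ {c}, Gᶜ.Adj x c → c ≠ v := by
    rintro v hv c hc rfl
    exact hc.2 hv
  have hay := hne hxy ha
  have haz := hne hxz ha
  have hdeg : ∀ v c d, c ≠ d → Gᶜ.Adj v c → Gᶜ.Adj v d → v ≠ x → v = a ∨ v = b := by
    intro v c d hcd hc hd hv
    have := h1 x a b v ha hb (h2 x v a b c d hv.symm hab hcd ha hb hc hd)
    grind
  have huniq : ∀ v, G.Adj x v → ∀ c d, Gᶜ.Adj v c → Gᶜ.Adj v d → c = d := by
    intro v hv c d hc hd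
    by_contra hcd
    have := hdeg v c d hcd hc hd hv.ne.symm
    have := hne hv ha
    have := hne hv hb
    grind
  obtain ⟨y₁, hy₁, hy₁'⟩ := exists_forall_eq_of_forall_eq a (huniq y hxy)
  obtain ⟨z₁, hz₁, hz₁'⟩ := exists_forall_eq_of_forall_eq a (huniq z hxz)
  -- The tree of `a` contains the path `z`–`y`–`x`, the star at `b` reaches `x` by the edge `zx`,
  -- and `y₁`, `z₁` make detours through `a`.
  refine hasEdgeDisjointSteinerTrees_of_scheme (w₀ := a) hxy.ne hyz.ne hxz.ne.symm
    ha.ne.symm hay haz a y₁ z₁ a b a _ fun w hw P h₃ h₄ h₅ h₆ h₇ h₈ h₉ => ?_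
  simp only [Finset.mem_compl, Finset.mem_insert, Finset.mem_singleton, not_or] at hw
  have hx := adj_or_compl_adj (G := G) hw.1
  have hy := adj_or_compl_adj (G := G) hw.2.1
  have hz := adj_or_compl_adj (G := G) hw.2.2
  have hay' := adj_or_compl_adj (G := G) hay
  have haz' := adj_or_compl_adj (G := G) haz
  have k₁ := hy₁' w
  have k₂ := hz₁' w
  have k₃ := hy₁' a
  have k₄ := hz₁' a
  have k₅ := h1 x a b w ha hb
  have hva : ∀ v, a ≠ v → ¬ Gᶜ.Adj v b → w ≠ a → Gᶜ.Adj v w → G.Adj w a := fun v hav hvb hwa hvw =>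
    (adj_or_compl_adj hwa).resolve_right fun h => by
      rcases hdeg w a v hav h.symm hvw.symm hw.1 with rfl | rfl
      · exact hwa rfl
      · exact hvb hvw
  have hya := hva y hay hby
  have hza := hva z haz hbz
  have hyz₁ : w ≠ a → Gᶜ.Adj z w → ¬ Gᶜ.Adj y w := fun hwa hzw hyw => by
    rcases hdeg w y z hyz.ne hyw.symm hzw.symm hw.1 with rfl | rfl
    · exact hwa rfl
    · exact hby hyw
  have k₆ := hxz.symm
  have k₇ := ha.ne
  clear h1 h2 hdeg hy₁' hz₁' hne huniq hva
  have h₃ := h₃ hw.1 hw.2.1 hw.2.2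
  by_cases e₀ : w = a
  all_goals by_cases e₁ : b = w
  all_goals by_cases e₂ : y₁ = w
  all_goals by_cases e₃ : z₁ = w
  all_goals grind

/-- Edge-disjoint Steiner trees when `{x, y, z}` is a triangle and its vertices have at most one
non-neighbour each. -/
theorem hasEdgeDisjointSteinerTrees_of_triangle
    (h1 : ∀ v a b c, Gᶜ.Adj v a → Gᶜ.Adj v b → Gᶜ.Adj v c → a = b ∨ b = c ∨ a = c)
    (hxy : G.Adj x y) (hxz : G.Adj x z) (hyz : G.Adj y z) (h₀ : w₀ ≠ x ∧ w₀ ≠ y ∧ w₀ ≠ z)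
    (hx : ∀ a b, Gᶜ.Adj x a → Gᶜ.Adj x b → a = b) (hy : ∀ a b, Gᶜ.Adj y a → Gᶜ.Adj y b → a = b)
    (hz : ∀ a b, Gᶜ.Adj z a → Gᶜ.Adj z b → a = b) :
    G.HasEdgeDisjointSteinerTrees {x, y, z} ({x, y, z} : Finset V)ᶜ.card := by
  obtain ⟨x₁, -, hx₁⟩ := exists_forall_eq_of_forall_eq w₀ hx
  obtain ⟨y₁, -, hy₁⟩ := exists_forall_eq_of_forall_eq w₀ hy
  obtain ⟨z₁, -, hz₁⟩ := exists_forall_eq_of_forall_eq w₀ hz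
  -- The triangle edges are allotted cyclically: `x₁` gets `xy`, `y₁` gets `yz`, `z₁` gets `zx`, so
  -- each missing edge is matched with its own triangle edge even when these vertices coincide.
  refine hasEdgeDisjointSteinerTrees_of_scheme (w₀ := w₀) hxy.ne hyz.ne hxz.ne.symm
    h₀.1 h₀.2.1 h₀.2.2 w₀ w₀ w₀ y₁ z₁ x₁ _ fun w hw P h₃ h₄ h₅ h₆ h₇ h₈ h₉ => ?_
  simp only [Finset.mem_compl, Finset.mem_insert, Finset.mem_singleton, not_or] at hw
  have hx := adj_or_compl_adj (G := G) hw.1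
  have hy := adj_or_compl_adj (G := G) hw.2.1
  have hz := adj_or_compl_adj (G := G) hw.2.2
  have k₁ := hx₁ w
  have k₂ := hy₁ w
  have k₃ := hz₁ w
  have k₄ : ¬ (Gᶜ.Adj x w ∧ Gᶜ.Adj y w ∧ Gᶜ.Adj z w) := fun ⟨h, h', h''⟩ => by
    rcases h1 w x y z h.symm h'.symm h''.symm with h | h | h
    exacts [hxy.ne h, hyz.ne h, hxz.ne h]
  have k₅ := hxz.symm
  clear h1 hx₁ hy₁ hz₁
  have h₃ := h₃ hw.1 hw.2.1 hw.2.2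
  by_cases e₀ : w = w₀
  all_goals by_cases e₁ : x₁ = w
  all_goals by_cases e₂ : y₁ = w
  all_goals by_cases e₃ : z₁ = w
  all_goals grind
end

section

variable {V : Type*} [Fintype V] [DecidableEq V] {G : SimpleGraph V}

theorem hasEdgeDisjointSteinerTrees_of_one_nonadj (hL : Gᶜ.IsNearMatching) {x y z w₀ : V}
    (hxy : Gᶜ.Adj x y) (hxz : G.Adj x z) (hyz : G.Adj y z) (h₀ : w₀ ≠ x ∧ w₀ ≠ y ∧ w₀ ≠ z) :
    G.HasEdgeDisjointSteinerTrees {x, y, z} ({x, y, z} : Finset V)ᶜ.card := by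
  by_cases hz : ∀ a b, Gᶜ.Adj z a → Gᶜ.Adj z b → a = b
  · by_cases hx : ∀ w, w ≠ y → ¬ Gᶜ.Adj x w
    · by_cases hy : ∀ w, w ≠ x → ¬ Gᶜ.Adj y w
      · exact hasEdgeDisjointSteinerTrees_of_one_nonadj_of_full hxy hxz hyz h₀ hx hy hz
      · push Not at hy
        obtain ⟨a, hax, ha⟩ := hy
        rw [Set.insert_comm, Finset.insert_comm]
        exact hasEdgeDisjointSteinerTrees_of_one_nonadj_of_nonadj hL hxy.symm hyz hxz hax ha
    · push Not at hx
      obtain ⟨a, hay, ha⟩ := hx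
      exact hasEdgeDisjointSteinerTrees_of_one_nonadj_of_nonadj hL hxy hxz hyz hay ha
  · push Not at hz
    obtain ⟨a, b, ha, hb, hab⟩ := hz
    exact hasEdgeDisjointSteinerTrees_of_one_nonadj_of_apex hL hxy hxz hyz hab ha hb

theorem hasEdgeDisjointSteinerTrees_of_triangle_of_two_nonadj (hL : Gᶜ.IsNearMatching)
    {x y z a b : V} (hxy : G.Adj x y) (hxz : G.Adj x z) (hyz : G.Adj y z) (hab : a ≠ b)
    (ha : Gᶜ.Adj x a) (hb : Gᶜ.Adj x b) :
    G.HasEdgeDisjointSteinerTrees {x, y, z} ({x, y, z} : Finset V)ᶜ.card := by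
  -- If `a` and `b` both had a complement neighbour among `y`, `z`, they would have complement
  -- degree at least 2 and be adjacent there, giving `a` three complement neighbours.
  have key : (¬ Gᶜ.Adj y b ∧ ¬ Gᶜ.Adj z b) ∨ (¬ Gᶜ.Adj y a ∧ ¬ Gᶜ.Adj z a) := by
    by_contra h
    have : ∃ u, x ≠ u ∧ u ≠ b ∧ Gᶜ.Adj a u := by
      by_cases hya : Gᶜ.Adj y a
      · exact ⟨y, hxy.ne, fun h => hb.2 (h ▸ hxy), hya.symm⟩
      · exact ⟨z, hxz.ne, fun h => hb.2 (h ▸ hxz), (by tauto : Gᶜ.Adj z a).symm⟩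
    obtain ⟨u, hxu, hub, hau⟩ := this
    have : ∃ v, x ≠ v ∧ Gᶜ.Adj b v := by
      by_cases hyb : Gᶜ.Adj y b
      · exact ⟨y, hxy.ne, hyb.symm⟩
      · exact ⟨z, hxz.ne, (by tauto : Gᶜ.Adj z b).symm⟩
    obtain ⟨v, hxv, hbv⟩ := this
    have hadj := hL.2 a b x u x v hab hxu hxv ha.symm hau hb.symm hbv
    rcases hL.1 a x b u ha.symm hadj hau with h | h | h
    exacts [hb.ne h, hub h.symm, hxu h]
  rcases key with h | h
  · exact hasEdgeDisjointSteinerTrees_of_triangle_of_apex hL hxy hxz hyz hab ha hb h.1 h.2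
  · exact hasEdgeDisjointSteinerTrees_of_triangle_of_apex hL hxy hxz hyz hab.symm hb ha h.1 h.2

/-- If the complement of `G` is a near-matching, then any three vertices are connected by `n - 3`
edge-disjoint Steiner trees. -/
theorem IsNearMatching.hasEdgeDisjointSteinerTrees (hL : Gᶜ.IsNearMatching) {S : Finset V}
    (hS : S.card = 3) : G.HasEdgeDisjointSteinerTrees (S : Set V) (Fintype.card V - 3) := by
  rw [← hS, ← Finset.card_compl]
  -- The scheme needs a vertex `w₀` outside `S`; without one, no trees are required.
  rcases Finset.eq_empty_or_nonempty Sᶜ with h | ⟨w₀, hw₀⟩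
  · rw [h]
    exact hasEdgeDisjointSteinerTrees_zero G _
  obtain ⟨x, y, z, hxy, hxz, hyz, rfl⟩ := Finset.card_eq_three.1 hS
  rw [Finset.mem_compl, Finset.mem_insert, Finset.mem_insert, Finset.mem_singleton, not_or,
    not_or] at hw₀
  have e₁ : ({x, y, z} : Finset V) = {y, z, x} := by grind
  have e₂ : ({x, y, z} : Finset V) = {z, x, y} := by grind
  have c : ∀ a b c : V, ((({a, b, c} : Finset V) : Set V)) = {a, b, c} := by simp
  have two : ∀ x y z : V, y ≠ z → Gᶜ.Adj x y → Gᶜ.Adj x z → w₀ ≠ x ∧ w₀ ≠ y ∧ w₀ ≠ z →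
      G.HasEdgeDisjointSteinerTrees (({x, y, z} : Finset V) : Set V)
        ({x, y, z} : Finset V)ᶜ.card := fun x y z hyz h h' h₀ => by
    rw [c]
    exact hasEdgeDisjointSteinerTrees_of_two_nonadj hL h h' hyz h₀
  have one : ∀ x y z : V, Gᶜ.Adj x y → G.Adj x z → G.Adj y z → w₀ ≠ x ∧ w₀ ≠ y ∧ w₀ ≠ z →
      G.HasEdgeDisjointSteinerTrees (({x, y, z} : Finset V) : Set V)
        ({x, y, z} : Finset V)ᶜ.card := fun x y z h h' h'' h₀ => by
    rw [c]
    exact hasEdgeDisjointSteinerTrees_of_one_nonadj hL h h' h'' h₀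
  have none : ∀ x y z a b : V, a ≠ b → Gᶜ.Adj x a → Gᶜ.Adj x b →
      G.Adj x y → G.Adj x z → G.Adj y z →
      G.HasEdgeDisjointSteinerTrees (({x, y, z} : Finset V) : Set V)
        ({x, y, z} : Finset V)ᶜ.card := fun x y z a b hab ha hb h h' h'' => by
    rw [c]
    exact hasEdgeDisjointSteinerTrees_of_triangle_of_two_nonadj hL h h' h'' hab ha hb
  have r₁ : w₀ ≠ y ∧ w₀ ≠ z ∧ w₀ ≠ x := by tauto
  have r₂ : w₀ ≠ z ∧ w₀ ≠ x ∧ w₀ ≠ y := by tauto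
  rcases adj_or_compl_adj (G := G) hxy with hxy' | hxy' <;>
  rcases adj_or_compl_adj (G := G) hyz with hyz' | hyz' <;>
  rcases adj_or_compl_adj (G := G) hxz with hxz' | hxz'
  · by_cases hx : ∀ a b, Gᶜ.Adj x a → Gᶜ.Adj x b → a = b
    · by_cases hy : ∀ a b, Gᶜ.Adj y a → Gᶜ.Adj y b → a = b
      · by_cases hz : ∀ a b, Gᶜ.Adj z a → Gᶜ.Adj z b → a = b
        · rw [c]
          exact hasEdgeDisjointSteinerTrees_of_triangle hL.1 hxy' hxz' hyz' hw₀ hx hy hz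
        · push Not at hz
          obtain ⟨a, b, ha, hb, hab⟩ := hz
          rw [e₂]
          exact none z x y a b hab ha hb hxz'.symm hyz'.symm hxy'
      · push Not at hy
        obtain ⟨a, b, ha, hb, hab⟩ := hy
        rw [e₁]
        exact none y z x a b hab ha hb hyz' hxy'.symm hxz'.symm
    · push Not at hx
      obtain ⟨a, b, ha, hb, hab⟩ := hx
      exact none x y z a b hab ha hb hxy' hxz' hyz'
  · rw [e₂]
    exact one z x y hxz' hyz'.symm hxy' r₂
  · rw [e₁]
    exact one y z x hyz'.symm hxy'.symm hxz'.symm r₁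
  · rw [e₂]
    exact two z x y hxy hxz' hyz' r₂
  · exact one x y z hxy'.symm hxz' hyz' hw₀
  · exact two x y z hyz hxy'.symm hxz'.symm hw₀
  · rw [e₁]
    exact two y z x hxz.symm hyz'.symm hxy' r₁
  · exact two x y z hyz hxy'.symm hxz'.symm hw₀

/-! ### At most one missing edge: constructing $n-2$ trees. -/

/-- The extra tree is indexed by `x` and is the path `y`–`z`–`x`. The edge `xy`, when present, is
left to repair the only star that can be defective, the one at the non-neighbour of `x`. -/
theorem hasEdgeDisjointSteinerTrees_compl_pair {x y z w₀ : V} (hxy : x ≠ y) (hxz : x ≠ z)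
    (hyz : y ≠ z) (h₀ : w₀ ≠ x ∧ w₀ ≠ y ∧ w₀ ≠ z) (hz : ∀ w, w ≠ z → G.Adj w z)
    (hy : ∀ w, w ≠ y → w ≠ x → G.Adj w y) (hx : ∀ a b, Gᶜ.Adj x a → Gᶜ.Adj x b → a = b) :
    G.HasEdgeDisjointSteinerTrees {x, y, z} ({y, z} : Finset V)ᶜ.card := by
  obtain ⟨x₁, -, hx₁⟩ := exists_forall_eq_of_forall_eq w₀ hx
  refine hasEdgeDisjointSteinerTrees_of_scheme (w₀ := w₀) hxy hyz hxz.symm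
    h₀.1 h₀.2.1 h₀.2.2 w₀ w₀ w₀ x x x₁ _ fun w hw P h₃ h₄ h₅ h₆ h₇ h₈ h₉ => ?_
  simp only [Finset.mem_compl, Finset.mem_insert, Finset.mem_singleton, not_or] at hw
  have hzw := hz w hw.2
  have hzx := (hz x hxz).symm
  have hzy := hz y hyz
  have hyw := hy w hw.1
  have k₁ := hx₁ w
  have k₂ := hx₁ y
  have k₃ := fun h : w ≠ x => adj_or_compl_adj (G := G) h
  have k₄ := adj_or_compl_adj (G := G) hxy.symm
  have k₅ := G.adj_comm x y
  clear hx₁ hx hy hz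
  by_cases e₀ : w = x
  · grind
  have h₃ := h₃ e₀ hw.1 hw.2
  by_cases e₁ : w = w₀
  all_goals by_cases e₂ : x₁ = w
  all_goals grind

/-- If at most one edge is missing in a graph with at least four vertices, then any three vertices
are connected by `n - 2` edge-disjoint Steiner trees. -/
theorem hasEdgeDisjointSteinerTrees_of_not_hasTwoEdges (hE : ¬ Gᶜ.HasTwoEdges)
    (hV : 4 ≤ Fintype.card V) {S : Finset V} (hS : S.card = 3) :
    G.HasEdgeDisjointSteinerTrees (S : Set V) (Fintype.card V - 2) := by
  have hE' : ∀ a b c d, Gᶜ.Adj a b → Gᶜ.Adj c d → (a = c ∧ b = d) ∨ (a = d ∧ b = c) := by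
    intro a b c d hab hcd
    by_contra h
    exact hE ⟨a, b, c, d, hab, hcd, fun h' => h (by simpa using h')⟩
  have hx : ∀ x a b, Gᶜ.Adj x a → Gᶜ.Adj x b → a = b := fun x a b ha hb => by
    have := hE' _ _ _ _ ha hb
    grind
  obtain ⟨w₀, hw₀⟩ : ∃ w₀, w₀ ∉ S := by
    by_contra! h
    have := Finset.card_le_card (fun v _ => h v : Finset.univ ⊆ S)
    rw [Finset.card_univ] at this
    omega
  have main : ∀ x y z, x ≠ y → x ≠ z → y ≠ z → S = {x, y, z} → (∀ w, w ≠ z → G.Adj w z) →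
      G.HasEdgeDisjointSteinerTrees (S : Set V) (Fintype.card V - 2) := by
    intro x y z hxy hxz hyz hS hz
    have key : (∀ w, w ≠ y → w ≠ x → G.Adj w y) ∨ (∀ w, w ≠ x → w ≠ y → G.Adj w x) := by
      by_contra! h
      obtain ⟨⟨w, h₁, h₂, h₃⟩, w', h₁', h₂', h₃'⟩ := h
      have := hE' _ _ _ _ ((adj_or_compl_adj h₁).resolve_left h₃)
        ((adj_or_compl_adj h₁').resolve_left h₃')
      grind
    rw [hS] at hw₀ ⊢
    rw [Finset.mem_insert, Finset.mem_insert, Finset.mem_singleton, not_or, not_or] at hw₀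
    rcases key with h | h
    · have := hasEdgeDisjointSteinerTrees_compl_pair hxy hxz hyz hw₀ hz h (hx x)
      rw [Finset.card_compl, Finset.card_pair hyz] at this
      simpa using this
    · have := hasEdgeDisjointSteinerTrees_compl_pair hxy.symm hyz hxz
        ⟨hw₀.2.1, hw₀.1, hw₀.2.2⟩ hz h (hx y)
      rw [Finset.card_compl, Finset.card_pair hxz, Set.insert_comm] at this
      simpa using this
  obtain ⟨x, y, z, hxy, hxz, hyz, hS⟩ := Finset.card_eq_three.1 hS
  by_cases hz : ∀ w, w ≠ z → G.Adj w z
  · exact main x y z hxy hxz hyz hS hz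
  by_cases hy : ∀ w, w ≠ y → G.Adj w y
  · exact main x z y hxz hxy hyz.symm (by grind) hy
  -- If neither `z` nor `y` is adjacent to all others, the only missing edge is `yz`, so `x` is.
  refine main y z x hyz hxy.symm hxz.symm (by grind) fun w hw => ?_
  push Not at hz hy
  obtain ⟨a, ha, ha'⟩ := hz
  obtain ⟨b, hb, hb'⟩ := hy
  refine (adj_or_compl_adj hw).resolve_right fun h => ?_
  have h₁ := hE' _ _ _ _ h ((adj_or_compl_adj ha).resolve_left ha')
  have h₂ := hE' _ _ _ _ h ((adj_or_compl_adj hb).resolve_left hb')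
  grind

end

/-! ### Reduction of the theorem to near-matchings. -/

/-- `λ₃(G) = n - 3` if and only if the complement of `G` is a near-matching with at least two
edges. -/
theorem generalizedEdgeConnectivity_three_eq_iff {V : Type*} [Fintype V] {G : SimpleGraph V}
    (hG : G.Connected) (h3 : 3 ≤ Fintype.card V) :
    G.generalizedEdgeConnectivity 3 = Fintype.card V - 3 ↔
      Gᶜ.IsNearMatching ∧ Gᶜ.HasTwoEdges := by
  classical
  have hcard : ∀ x y z : V, x ≠ y → x ≠ z → y ≠ z → ({x, y, z} : Finset V).card = 3 :=
    fun x y z h h' h'' => Finset.card_eq_three.2 ⟨x, y, z, h, h', h'', rfl⟩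
  have hdeg : ∀ (v : V) (A : Finset V), (∀ a ∈ A, Gᶜ.Adj v a) →
      G.degree v + A.card + 1 ≤ Fintype.card V := by
    intro v A hA
    have h₁ := G.degree_compl v
    have h₂ : A.card ≤ Gᶜ.degree v := by
      rw [← card_neighborFinset_eq_degree]
      exact Finset.card_le_card fun a ha => (mem_neighborFinset _ _ _).2 (hA a ha)
    have h₃ := G.degree_lt_card_verts v
    omega
  have h₁ := le_generalizedEdgeConnectivity_iff G (by norm_num : 2 ≤ 3) h3 (Fintype.card V - 3)
  have h₂ := le_generalizedEdgeConnectivity_iff G (by norm_num : 2 ≤ 3) h3 (Fintype.card V - 2)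
  -- As the order is at least 3, the truncated differences $n-3$ and $n-2$ are consecutive.
  have upper : G.generalizedEdgeConnectivity 3 = Fintype.card V - 3 ↔
      Fintype.card V - 3 ≤ G.generalizedEdgeConnectivity 3 ∧
        ¬ Fintype.card V - 2 ≤ G.generalizedEdgeConnectivity 3 := by omega
  rw [upper, h₁, h₂]
  have hdeg2 : ∀ u a b, a ≠ b → Gᶜ.Adj u a → Gᶜ.Adj u b → G.degree u ≤ Fintype.card V - 3 := by
    intro u a b hab ha hb
    have := hdeg u {a, b} (by simp [-compl_adj, ha, hb])
    rw [Finset.card_pair hab] at this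
    omega
  refine and_congr ⟨fun h => ⟨?_, ?_⟩, fun h S hS => h.hasEdgeDisjointSteinerTrees hS⟩
    ⟨fun h => ?_, fun h h' => ?_⟩
  · intro v a b c ha hb hc
    by_contra! hne
    have hd := hdeg v {a, b, c} (by simp [-compl_adj, ha, hb, hc])
    rw [hcard a b c hne.1 hne.2.2 hne.2.1] at hd
    have := h _ (hcard v a b ha.ne hb.ne hne.1)
    have := this.le_degree (u := v) ⟨v, by simp, a, by simp, ha.ne⟩ (by simp)
    omega
  · intro u v a b c d huv hab hcd ha hb hc hd
    by_contra hnot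
    have huv' := (adj_or_compl_adj (G := G) huv).resolve_right fun h => hnot h.symm
    obtain ⟨x, hx⟩ : ∃ x, x ∉ ({u, v} : Finset V) := by
      by_contra! hall
      have := Finset.card_le_card (fun v _ => hall v : Finset.univ ⊆ ({u, v} : Finset V))
      rw [Finset.card_univ, Finset.card_pair huv] at this
      omega
    rw [Finset.mem_insert, Finset.mem_singleton, not_or] at hx
    have := h _ (hcard u v x huv (Ne.symm hx.1) (Ne.symm hx.2))
    exact not_hasEdgeDisjointSteinerTrees_of_adj (x := x) (by simp) (by simp) (by simp) hx.1 hx.2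
      huv' (hdeg2 u a b hab ha hb) (hdeg2 v c d hcd hc hd) this
  · by_contra hE
    refine h fun S hS => ?_
    rcases h3.lt_or_eq with h4 | h3
    · exact hasEdgeDisjointSteinerTrees_of_not_hasTwoEdges hE h4 hS
    -- For order 3 the bound $n-2$ is 1, and connectedness supplies the one tree.
    · rw [← h3]
      exact hG.hasEdgeDisjointSteinerTrees_one _
  · obtain ⟨a, b, c, d, hab, hcd, hne⟩ := h
    have h2' : ∀ u a b, a ≠ b → Gᶜ.Adj u a → Gᶜ.Adj u b → False := by
      intro u a b hab ha hb
      have := h' _ (hcard u a b ha.ne hb.ne hab)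
      have := this.le_degree (u := u) ⟨u, by simp, a, by simp, ha.ne⟩ (by simp)
      have := hdeg2 u a b hab ha hb
      omega
    have hdeg1 : ∀ u a, Gᶜ.Adj u a → G.degree u ≤ Fintype.card V - 2 := by
      intro u a ha
      have := hdeg u {a} (by simpa using ha)
      rw [Finset.card_singleton] at this
      omega
    -- By `h2'` no vertex lies on two missing edges, so `a`, `b`, `c` are distinct and `ac` is an
    -- edge of `G`. Both its ends have degree at most $n-2$, which rules out $n-2$ trees for `{a, c,
    -- b}`.
    have hac : a ≠ c := by
      rintro rfl
      exact h2' a b d (fun h => hne (by rw [h])) hab hcd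
    have hbc : b ≠ c := by
      rintro rfl
      exact h2' b a d (fun h => hne (by rw [h, Sym2.eq_swap])) hab.symm hcd
    have hac' := (adj_or_compl_adj (G := G) hac).resolve_right fun h =>
      h2' a b c hbc hab h.symm
    exact not_hasEdgeDisjointSteinerTrees_of_adj (x := b) (by simp) (by simp) (by simp)
      hab.ne.symm hbc hac' (hdeg1 a b hab) (hdeg1 c d hcd) (h' _ (hcard a c b hac hab.ne hbc.symm))

/-! ### Classification of near-matchings up to isomorphism. -/

section

variable {V W : Type*} {G : SimpleGraph V} {H : SimpleGraph W}

/-- A graph is the disjoint union of an embedded graph without edges to the outside and the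
subgraph induced by the remaining vertices. -/
theorem nonempty_iso_sum_induce (f : G ↪g H)
    (hf : ∀ v w, w ∉ Set.range f → ¬ H.Adj (f v) w) :
    Nonempty (H ≃g G ⊕g H.induce (Set.range f)ᶜ) := by
  classical
  let e : V ⊕ ((Set.range f)ᶜ : Set W) ≃ W :=
    (Equiv.sumCongr (Equiv.ofInjective f f.injective) (Equiv.refl _)).trans
      (Equiv.Set.sumCompl (Set.range f))
  have hl : ∀ v, e (.inl v) = f v := fun v => rfl
  have hr : ∀ w, e (.inr w) = w := fun w => rfl
  refine ⟨(Iso.symm ⟨e, ?_⟩ : H ≃g G ⊕g H.induce (Set.range f)ᶜ)⟩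
  rintro (u | u) (v | v)
  · rw [hl, hl, f.map_adj_iff, sum_adj_inl]
  · rw [hl, hr]
    exact iff_of_false (hf u v v.2) (by simp)
  · rw [hl, hr, H.adj_comm]
    exact iff_of_false (hf v u u.2) (by simp)
  · rw [hr, hr, sum_adj_inr, comap_adj]
    rfl

theorem nonempty_iso_bot_fin [Fintype V] (hG : ∀ u v, ¬ G.Adj u v) {n : ℕ}
    (hn : Fintype.card V = n) : Nonempty (G ≃g (⊥ : SimpleGraph (Fin n))) :=
  ⟨⟨Fintype.equivFinOfCardEq hn, fun {u v} => iff_of_false (by simp) (hG u v)⟩⟩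

/-- A graph of maximum degree at most one is a union of copies of `P₂` and isolated vertices. -/
theorem exists_iso_copies_sum_bot [Fintype V] (hG : ∀ v a b, G.Adj v a → G.Adj v b → a = b) :
    ∃ t, 2 * t ≤ Fintype.card V ∧ Nonempty
      (G ≃g copies t (pathGraph 2) ⊕g (⊥ : SimpleGraph (Fin (Fintype.card V - 2 * t)))) := by
  classical
  let t := Fintype.card G.edgeSet
  let e : Fin t ≃ G.edgeSet := (Fintype.equivFin _).symm
  have he : ∀ i, ∃ p : Fin 2 → V, G.Adj (p 0) (p 1) ∧ (e i : Sym2 V) = s(p 0, p 1) := by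
    intro i
    obtain ⟨⟨a, b⟩, h⟩ := e i
    exact ⟨![a, b], h, rfl⟩
  choose p hp hpe using he
  have hadj : ∀ i j k l, G.Adj (p i k) (p j l) ↔ i = j ∧ k ≠ l := by
    have hfwd : ∀ i k l, k ≠ l → G.Adj (p i k) (p i l) := by
      intro i k l hkl
      fin_cases k <;> fin_cases l <;> first | exact absurd rfl hkl | exact hp i | exact (hp i).symm
    -- In `Fin 2`, `1 - k` is the index of the other end of the edge.
    have hsym : ∀ i (k : Fin 2), (e i : Sym2 V) = s(p i k, p i (1 - k)) := by
      intro i k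
      fin_cases k
      · exact hpe i
      · exact (hpe i).trans Sym2.eq_swap
    intro i j k l
    refine ⟨fun h => ?_, fun ⟨h, h'⟩ => h ▸ hfwd i k l h'⟩
    have hk : k ≠ 1 - k := by clear * -; revert k; decide
    have hl : l ≠ 1 - l := by clear * -; revert l; decide
    have h₁ := hG _ _ _ h (hfwd i k (1 - k) hk)
    have h₂ := hG _ _ _ h.symm (hfwd j l (1 - l) hl)
    have hij : i = j := e.injective (Subtype.ext (by
      rw [hsym i k, hsym j l, ← h₁, ← h₂, Sym2.eq_swap]))
    subst hij
    exact ⟨rfl, fun hkl => h.ne (hkl ▸ rfl)⟩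
  have hinj : Function.Injective fun q : Fin t × Fin 2 => p q.1 q.2 := by
    rintro ⟨i, k⟩ ⟨j, l⟩ h
    have h : p i k = p j l := h
    have hk : k ≠ 1 - k := by clear * -; revert k; decide
    have h₁ := (hadj i i k (1 - k)).2 ⟨rfl, hk⟩
    rw [h, hadj] at h₁
    have : k = l := by
      have h₁ := h₁.2
      omega
    exact Prod.ext h₁.1.symm this
  let f : copies t (pathGraph 2) ↪g G := ⟨⟨_, hinj⟩, by
    rintro ⟨i, k⟩ ⟨j, l⟩
    refine (hadj i j k l).trans (and_congr_right fun _ => ?_)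
    rw [pathGraph_two_eq_top, top_adj]⟩
  have hcover : ∀ u v, G.Adj u v → u ∈ Set.range f := by
    intro u v huv
    obtain ⟨i, hi⟩ := e.surjective ⟨s(u, v), huv⟩
    have := hpe i
    rw [hi] at this
    rcases Sym2.eq_iff.1 this with h | h
    · exact ⟨(i, 0), h.1.symm⟩
    · exact ⟨(i, 1), h.1.symm⟩
  obtain ⟨φ⟩ := nonempty_iso_sum_induce f fun v w hw h => hw (hcover _ _ h.symm)
  have hcard := Fintype.card_congr φ.toEquiv
  rw [Fintype.card_sum, Fintype.card_prod, Fintype.card_fin, Fintype.card_fin] at hcard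
  obtain ⟨ψ⟩ := nonempty_iso_bot_fin (G := G.induce (Set.range f)ᶜ)
    (fun u v h => u.2 (hcover _ _ h)) (n := Fintype.card V - 2 * t) (by omega)
  exact ⟨t, by omega, ⟨φ.trans (Iso.sumCongr (Iso.refl) ψ)⟩⟩

/-- A graph with an induced subgraph that has no edges to the outside, and maximum degree at most
one outside that part. -/
theorem exists_iso_sum_copies_sum_bot [Fintype V] {k : ℕ} {A : SimpleGraph (Fin k)}
    (p : Fin k → V) (hp : Function.Injective p) (hA : ∀ i j, G.Adj (p i) (p j) ↔ A.Adj i j)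
    (hf : ∀ i w, w ∉ Set.range p → ¬ G.Adj (p i) w)
    (hG : ∀ v a b, v ∉ Set.range p → G.Adj v a → G.Adj v b → a = b) :
    ∃ t, 2 * t + k ≤ Fintype.card V ∧ Nonempty (G ≃g A ⊕g copies t (pathGraph 2) ⊕g
      (⊥ : SimpleGraph (Fin (Fintype.card V - 2 * t - k)))) := by
  classical
  let f : A ↪g G := ⟨⟨p, hp⟩, hA _ _⟩
  obtain ⟨φ⟩ := nonempty_iso_sum_induce f hf
  have hcard := Fintype.card_congr φ.toEquiv
  rw [Fintype.card_sum, Fintype.card_fin] at hcard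
  obtain ⟨t, ht, ⟨ψ⟩⟩ := exists_iso_copies_sum_bot (G := G.induce (Set.range f)ᶜ)
    fun v a b ha hb => Subtype.ext (hG v a b v.2 ha hb)
  have : Fintype.card ((Set.range f)ᶜ : Set V) - 2 * t = Fintype.card V - 2 * t - k := by omega
  rw [this] at ψ
  exact ⟨t, by omega, ⟨(φ.trans (Iso.sumCongr Iso.refl ψ)).trans Iso.sumAssoc.symm⟩⟩

theorem IsNearMatching.of_embedding (hH : H.IsNearMatching) (f : G ↪g H) : G.IsNearMatching := by
  refine ⟨fun v a b c ha hb hc => ?_, fun u v a b c d huv hab hcd ha hb hc hd => ?_⟩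
  · simpa using hH.1 (f v) (f a) (f b) (f c) (f.map_adj_iff.2 ha) (f.map_adj_iff.2 hb)
      (f.map_adj_iff.2 hc)
  · exact f.map_adj_iff.1 (hH.2 (f u) (f v) (f a) (f b) (f c) (f d) (f.injective.ne huv)
      (f.injective.ne hab) (f.injective.ne hcd) (f.map_adj_iff.2 ha) (f.map_adj_iff.2 hb)
      (f.map_adj_iff.2 hc) (f.map_adj_iff.2 hd))

theorem HasTwoEdges.of_embedding (hG : G.HasTwoEdges) (f : G ↪g H) : H.HasTwoEdges := by
  obtain ⟨a, b, c, d, hab, hcd, hne⟩ := hG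
  exact ⟨f a, f b, f c, f d, f.map_adj_iff.2 hab, f.map_adj_iff.2 hcd,
    fun h => hne (Sym2.map.injective f.injective h)⟩

theorem isNearMatching_of_forall_eq (hG : ∀ v a b, G.Adj v a → G.Adj v b → a = b) :
    G.IsNearMatching :=
  ⟨fun v a b _ ha hb _ => .inl (hG v a b ha hb),
    fun u _ a b _ _ _ hab _ ha hb _ _ => absurd (hG u a b ha hb) hab⟩

theorem IsNearMatching.sum (hG : G.IsNearMatching)
    (hH : ∀ v a b, H.Adj v a → H.Adj v b → a = b) : (G ⊕g H).IsNearMatching := by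
  refine ⟨?_, ?_⟩
  · rintro (v | v) (a | a) (b | b) (c | c) <;> simp only [sum_adj, Sum.inl.injEq, Sum.inr.injEq,
      reduceCtorEq, false_implies, implies_true]
    · exact hG.1 v a b c
    · exact fun ha hb _ => .inl (hH v a b ha hb)
  · rintro (u | u) (v | v) (a | a) (b | b) (c | c) (d | d) <;> simp only [sum_adj, ne_eq,
      Sum.inl.injEq, Sum.inr.injEq, reduceCtorEq, false_implies, implies_true]
    · exact hG.2 u v a b c d
    · exact fun _ _ hcd _ _ hc hd => absurd (hH v c d hc hd) hcd
    · exact fun _ hab _ ha hb _ _ => absurd (hH u a b ha hb) hab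
    · exact fun _ hab _ ha hb _ _ => absurd (hH u a b ha hb) hab

theorem eq_of_adj_copies_path_two {t : ℕ} (v a b : Fin t × Fin 2)
    (ha : (copies t (pathGraph 2)).Adj v a) (hb : (copies t (pathGraph 2)).Adj v b) : a = b := by
  obtain ⟨h₁, h₂⟩ := ha
  obtain ⟨h₃, h₄⟩ := hb
  rw [pathGraph_two_eq_top, top_adj] at h₂ h₄
  exact Prod.ext (h₁.symm.trans h₃) (by omega)

theorem IsNearMatching.sum_copies_sum_bot (hG : G.IsNearMatching) {t m : ℕ} :
    (G ⊕g copies t (pathGraph 2) ⊕g (⊥ : SimpleGraph (Fin m))).IsNearMatching :=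
  (hG.sum eq_of_adj_copies_path_two).sum fun _ _ _ h => h.elim

theorem hasTwoEdges_of_adj {v a b : V} (hab : a ≠ b) (ha : G.Adj v a) (hb : G.Adj v b) :
    G.HasTwoEdges :=
  ⟨v, a, v, b, ha, hb, fun h => hab (Sym2.congr_right.1 h)⟩

theorem isNearMatching_path_four : (pathGraph 4).IsNearMatching := by
  simp only [IsNearMatching, pathGraph_adj]
  refine ⟨by decide, fun u v a b c d => ?_⟩
  omega

theorem isNearMatching_path_three : (pathGraph 3).IsNearMatching := by
  simp only [IsNearMatching, pathGraph_adj]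
  refine ⟨by decide, fun u v a b c d => ?_⟩
  omega

theorem isNearMatching_cycle_three : (cycleGraph 3).IsNearMatching := by
  rw [cycleGraph_three_eq_top]
  exact ⟨by simp only [top_adj]; decide, fun u v _ _ _ _ huv _ _ _ _ _ _ => huv⟩

theorem IsNearMatching.eq_or_eq_of_adj {v a b w : V} (hL : G.IsNearMatching)
    (ha : G.Adj v a) (hb : G.Adj v b) (hab : a ≠ b) (hw : G.Adj v w) : w = a ∨ w = b := by
  have := hL.1 v a b w ha hb hw
  grind

theorem IsNearMatching.eq_or_eq_of_adj_of_adj {v a b w c d : V}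
    (hL : G.IsNearMatching) (ha : G.Adj v a) (hb : G.Adj v b) (hab : a ≠ b)
    (hw : w ≠ v) (hcd : c ≠ d)
    (hc : G.Adj w c) (hd : G.Adj w d) : w = a ∨ w = b :=
  hL.eq_or_eq_of_adj ha hb hab (hL.2 v w a b c d hw.symm hab hcd ha hb hc hd)

theorem IsNearMatching.exists_iso_cycle_three [Fintype V] {v a b : V} (hL : G.IsNearMatching)
    (ha : G.Adj v a) (hb : G.Adj v b) (hab : a ≠ b) (hab' : G.Adj a b) :
    ∃ t : ℕ, 2 * t + 3 ≤ Fintype.card V ∧ Nonempty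
      (G ≃g (cycleGraph 3 ⊕g copies t (pathGraph 2) ⊕g
        (⊥ : SimpleGraph (Fin (Fintype.card V - 2 * t - 3))))) := by
  have hf : ∀ w, w ∉ Set.range ![v, a, b] → w ≠ v ∧ w ≠ a ∧ w ≠ b := fun w hw =>
    ⟨fun h => hw ⟨0, h.symm⟩, fun h => hw ⟨1, h.symm⟩, fun h => hw ⟨2, h.symm⟩⟩
  have hinj : Function.Injective ![v, a, b] := by
    intro i j
    fin_cases i <;> fin_cases j <;> simp [hab, hab.symm, ha.ne, ha.ne.symm, hb.ne, hb.ne.symm]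
  refine exists_iso_sum_copies_sum_bot ![v, a, b] hinj ?_ ?_ ?_
  · intro i j
    rw [cycleGraph_three_eq_top]
    fin_cases i <;> fin_cases j <;> simp [ha, hb, hab', ha.symm, hb.symm, hab'.symm]
  · intro i w hw h
    obtain ⟨h₁, h₂, h₃⟩ := hf w hw
    fin_cases i
    · exact (hL.eq_or_eq_of_adj ha hb hab h).elim h₂ h₃
    · exact (hL.eq_or_eq_of_adj ha.symm hab' hb.ne h).elim h₁ h₃
    · exact (hL.eq_or_eq_of_adj hb.symm hab'.symm ha.ne h).elim h₁ h₂
  · intro w c d hw hc hd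
    obtain ⟨h₁, h₂, h₃⟩ := hf w hw
    by_contra hcd
    exact (hL.eq_or_eq_of_adj_of_adj ha hb hab h₁ hcd hc hd).elim h₂ h₃

/-- The path is `c`–`a`–`v`–`b`, with `a` and `v` of degree 2. A second neighbour of `c` would make
`c` adjacent to `v`, and one of `b` would make `a` and `b` adjacent; both are excluded. -/
theorem IsNearMatching.exists_iso_path_four [Fintype V] {v a b : V} (hL : G.IsNearMatching)
    (ha : G.Adj v a) (hb : G.Adj v b) (hab : a ≠ b) (hab' : ¬ G.Adj a b) {c : V} (hcv : c ≠ v)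
    (hac : G.Adj a c) :
    ∃ s : ℕ, 2 * s + 4 ≤ Fintype.card V ∧ Nonempty
      (G ≃g (pathGraph 4 ⊕g copies s (pathGraph 2) ⊕g
        (⊥ : SimpleGraph (Fin (Fintype.card V - 2 * s - 4))))) := by
  have hcb : c ≠ b := fun h => hab' (h ▸ hac)
  have hvc : ¬ G.Adj v c := fun h =>
    (hL.eq_or_eq_of_adj ha hb hab h).elim hac.ne.symm hcb
  have hbc : ¬ G.Adj b c := fun h =>
    (hL.eq_or_eq_of_adj_of_adj ha hb hab hcv hab hac.symm h.symm).elim hac.ne.symm hcb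
  have hf : ∀ w, w ∉ Set.range ![c, a, v, b] → w ≠ c ∧ w ≠ a ∧ w ≠ v ∧ w ≠ b := fun w hw =>
    ⟨fun h => hw ⟨0, h.symm⟩, fun h => hw ⟨1, h.symm⟩, fun h => hw ⟨2, h.symm⟩,
      fun h => hw ⟨3, h.symm⟩⟩
  have hinj : Function.Injective ![c, a, v, b] := by
    intro i j
    fin_cases i <;> fin_cases j <;> simp [hab, hab.symm, ha.ne, ha.ne.symm, hb.ne,
      hb.ne.symm, hcv, hcv.symm, hcb, hcb.symm, hac.ne, hac.ne.symm]
  refine exists_iso_sum_copies_sum_bot ![c, a, v, b] hinj ?_ ?_ ?_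
  · intro i j
    rw [pathGraph_adj]
    fin_cases i <;> fin_cases j <;> simp [ha, hb, hab', ha.symm, hb.symm, hac, hac.symm,
      hvc, hbc, G.adj_comm c v, G.adj_comm c b, G.adj_comm b a]
  · intro i w hw h
    obtain ⟨h₁, h₂, h₃, h₄⟩ := hf w hw
    fin_cases i
    · exact (hL.eq_or_eq_of_adj_of_adj ha hb hab hcv h₂.symm hac.symm h).elim hac.ne.symm hcb
    · exact (hL.eq_or_eq_of_adj ha.symm hac hcv.symm h).elim h₃ h₁
    · exact (hL.eq_or_eq_of_adj ha hb hab h).elim h₂ h₄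
    · exact hab' (hL.2 a b v c v w hab hcv.symm h₃.symm ha.symm hac hb.symm h)
  · intro w c' d hw hc hd
    obtain ⟨h₁, h₂, h₃, h₄⟩ := hf w hw
    by_contra hcd
    exact (hL.eq_or_eq_of_adj_of_adj ha hb hab h₃ hcd hc hd).elim h₂ h₄

theorem IsNearMatching.exists_iso_path_three [Fintype V] {v a b : V} (hL : G.IsNearMatching)
    (ha : G.Adj v a) (hb : G.Adj v b) (hab : a ≠ b) (hab' : ¬ G.Adj a b)
    (hca : ∀ c, c ≠ v → ¬ G.Adj a c) (hcb : ∀ c, c ≠ v → ¬ G.Adj b c) :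
    ∃ t : ℕ, 2 * t + 3 ≤ Fintype.card V ∧ Nonempty
      (G ≃g (pathGraph 3 ⊕g copies t (pathGraph 2) ⊕g
        (⊥ : SimpleGraph (Fin (Fintype.card V - 2 * t - 3))))) := by
  have hf : ∀ w, w ∉ Set.range ![a, v, b] → w ≠ a ∧ w ≠ v ∧ w ≠ b := fun w hw =>
    ⟨fun h => hw ⟨0, h.symm⟩, fun h => hw ⟨1, h.symm⟩, fun h => hw ⟨2, h.symm⟩⟩
  have hinj : Function.Injective ![a, v, b] := by
    intro i j
    fin_cases i <;> fin_cases j <;> simp [hab, hab.symm, ha.ne, ha.ne.symm, hb.ne, hb.ne.symm]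
  refine exists_iso_sum_copies_sum_bot ![a, v, b] hinj ?_ ?_ ?_
  · intro i j
    rw [pathGraph_adj]
    fin_cases i <;> fin_cases j <;> simp [ha, hb, hab', ha.symm, hb.symm, G.adj_comm b a]
  · intro i w hw h
    obtain ⟨h₁, h₂, h₃⟩ := hf w hw
    fin_cases i
    · exact hca w h₂ h
    · exact (hL.eq_or_eq_of_adj ha hb hab h).elim h₁ h₃
    · exact hcb w h₂ h
  · intro w c d hw hc hd
    obtain ⟨h₁, h₂, h₃⟩ := hf w hw
    by_contra hcd
    exact (hL.eq_or_eq_of_adj_of_adj ha hb hab h₂ hcd hc hd).elim h₁ h₃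

/-- The near-matchings with at least two edges. -/
theorem isNearMatching_and_hasTwoEdges_iff [Fintype V] :
    G.IsNearMatching ∧ G.HasTwoEdges ↔
      (∃ r : ℕ, 2 ≤ r ∧ 2 * r ≤ Fintype.card V ∧ Nonempty
        (G ≃g (copies r (pathGraph 2) ⊕g (⊥ : SimpleGraph (Fin (Fintype.card V - 2 * r)))))) ∨
      (∃ s : ℕ, 2 * s + 4 ≤ Fintype.card V ∧ Nonempty
        (G ≃g (pathGraph 4 ⊕g copies s (pathGraph 2) ⊕g
          (⊥ : SimpleGraph (Fin (Fintype.card V - 2 * s - 4)))))) ∨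
      (∃ t : ℕ, 2 * t + 3 ≤ Fintype.card V ∧ Nonempty
        (G ≃g (pathGraph 3 ⊕g copies t (pathGraph 2) ⊕g
          (⊥ : SimpleGraph (Fin (Fintype.card V - 2 * t - 3)))))) ∨
      (∃ t : ℕ, 2 * t + 3 ≤ Fintype.card V ∧ Nonempty
        (G ≃g (cycleGraph 3 ⊕g copies t (pathGraph 2) ⊕g
          (⊥ : SimpleGraph (Fin (Fintype.card V - 2 * t - 3)))))) := by
  constructor
  · rintro ⟨hL, hE⟩
    by_cases hM : ∀ v a b, G.Adj v a → G.Adj v b → a = b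
    · obtain ⟨t, ht, ⟨φ⟩⟩ := exists_iso_copies_sum_bot hM
      refine .inl ⟨t, ?_, ht, ⟨φ⟩⟩
      by_contra! ht2
      have : Subsingleton (Fin t) := Fin.subsingleton_iff_le_one.2 (by omega)
      -- With at most one copy of $P_2$, any two edges of the normal form coincide.
      obtain ⟨a, b, c, d, hab, hcd, hne⟩ := hE.of_embedding φ.toEmbedding
      rcases a with ⟨i, k⟩ | a <;> rcases b with ⟨i', k'⟩ | b <;>
      rcases c with ⟨j, l⟩ | c <;> rcases d with ⟨j', l'⟩ | d <;> simp [copies] at hab hcd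
      obtain rfl := Subsingleton.elim i i'
      obtain rfl := Subsingleton.elim i j
      obtain rfl := Subsingleton.elim i j'
      rw [pathGraph_two_eq_top, top_adj] at hab hcd
      apply hne
      have : (k = l ∧ k' = l') ∨ (k = l' ∧ k' = l) := by omega
      rcases this with ⟨rfl, rfl⟩ | ⟨rfl, rfl⟩
      exacts [rfl, Sym2.eq_swap]
    · push Not at hM
      obtain ⟨v, a, b, ha, hb, hab⟩ := hM
      by_cases hab' : G.Adj a b
      · exact .inr (.inr (.inr (hL.exists_iso_cycle_three ha hb hab hab')))
      by_cases hca : ∃ c, c ≠ v ∧ G.Adj a c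
      · obtain ⟨c, hc, hac⟩ := hca
        exact .inr (.inl (hL.exists_iso_path_four ha hb hab hab' hc hac))
      by_cases hcb : ∃ c, c ≠ v ∧ G.Adj b c
      · obtain ⟨c, hc, hbc⟩ := hcb
        exact .inr (.inl (hL.exists_iso_path_four hb ha hab.symm (fun h => hab' h.symm) hc hbc))
      push Not at hca hcb
      exact .inr (.inr (.inl (hL.exists_iso_path_three ha hb hab hab' hca hcb)))
  · have core : ∀ {k t m : ℕ} {A : SimpleGraph (Fin k)}, A.IsNearMatching → A.HasTwoEdges →
        Nonempty (G ≃g A ⊕g copies t (pathGraph 2) ⊕g (⊥ : SimpleGraph (Fin m))) →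
        G.IsNearMatching ∧ G.HasTwoEdges := fun hA hA' ⟨φ⟩ =>
      ⟨hA.sum_copies_sum_bot.of_embedding φ.toEmbedding, ((hA'.of_embedding
        Embedding.sumInl).of_embedding Embedding.sumInl).of_embedding φ.symm.toEmbedding⟩
    rintro (⟨r, hr, -, ⟨φ⟩⟩ | ⟨s, -, φ⟩ | ⟨t, -, φ⟩ | ⟨t, -, φ⟩)
    · have hM : (copies r (pathGraph 2) ⊕g
          (⊥ : SimpleGraph (Fin (Fintype.card V - 2 * r)))).IsNearMatching :=
        (isNearMatching_of_forall_eq eq_of_adj_copies_path_two).sum fun _ _ _ h => h.elim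
      refine ⟨hM.of_embedding φ.toEmbedding, ?_⟩
      refine HasTwoEdges.of_embedding ?_ (φ.symm.toEmbedding.comp Embedding.sumInl)
      refine ⟨(⟨0, by omega⟩, 0), (⟨0, by omega⟩, 1), (⟨1, by omega⟩, 0), (⟨1, by omega⟩, 1),
        ⟨rfl, pathGraph_adj.2 (by simp)⟩, ⟨rfl, pathGraph_adj.2 (by simp)⟩, ?_⟩
      simp
    · exact core isNearMatching_path_four (hasTwoEdges_of_adj (v := 1) (a := 0) (b := 2)
        (by decide) (pathGraph_adj.2 (by decide)) (pathGraph_adj.2 (by decide))) φ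
    · exact core isNearMatching_path_three (hasTwoEdges_of_adj (v := 1) (a := 0) (b := 2)
        (by decide) (pathGraph_adj.2 (by decide)) (pathGraph_adj.2 (by decide))) φ
    · exact core isNearMatching_cycle_three (hasTwoEdges_of_adj (v := 1) (a := 0) (b := 2)
        (by decide) (by rw [cycleGraph_three_eq_top]; simp)
        (by rw [cycleGraph_three_eq_top]; simp)) φ

end

end SimpleGraph

open SimpleGraph in
theorem mainTheorem1 {V : Type*} [Fintype V] (G : SimpleGraph V) (hG : G.Connected)
    (n : ℕ) (hn : Fintype.card V = n) (h3 : 3 ≤ n) :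
    G.generalizedEdgeConnectivity 3 = n - 3 ↔
      (∃ r : ℕ, 2 ≤ r ∧ 2 * r ≤ n ∧
        Nonempty (Gᶜ ≃g (copies r (pathGraph 2) ⊕g (⊥ : SimpleGraph (Fin (n - 2 * r)))))) ∨
      (∃ s : ℕ, 2 * s + 4 ≤ n ∧
        Nonempty (Gᶜ ≃g
          (pathGraph 4 ⊕g copies s (pathGraph 2) ⊕g
            (⊥ : SimpleGraph (Fin (n - 2 * s - 4)))))) ∨
      (∃ t : ℕ, 2 * t + 3 ≤ n ∧
        Nonempty (Gᶜ ≃g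
          (pathGraph 3 ⊕g copies t (pathGraph 2) ⊕g
            (⊥ : SimpleGraph (Fin (n - 2 * t - 3)))))) ∨
      (∃ t : ℕ, 2 * t + 3 ≤ n ∧
        Nonempty (Gᶜ ≃g
          (cycleGraph 3 ⊕g copies t (pathGraph 2) ⊕g
            (⊥ : SimpleGraph (Fin (n - 2 * t - 3)))))) := by
  subst hn
  rw [generalizedEdgeConnectivity_three_eq_iff hG h3]
  exact isNearMatching_and_hasTwoEdges_iff
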